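/- **Setting.** Let $T,d\in\mathbb N$, let $(\Omega,\mathcal F,P)$ be a probability space with a filtration $(\mathcal F_t)_{t=0,\dots,T}$ such that $\mathcal F_0=\{A\in\mathcal F: P(A)\in\{0,1\}\}$ (the trivial $\sigma$-field completed by the $P$-null sets of $\mathcal F$). For $t=1,\dots,T$ let $R_t$ be an $\mathcal F_t$-measurable $\mathbb R^d$-valued random vector (the asset returns on $[t-1,t]$) with $R^i_t\ge -1$ a.s. for all $i$. Let $\mathcal S_t(\omega)$ be the topological support of a regular version of the $\mathcal F_{t-1}$-conditional distribution of $R_t$, $\mathcal L_t$ the linear span of $\mathcal S_t$, and $\mathcal L_t^\perp$ its orthogonal complement. Let $\Theta_{{\rm c},t}$ be random sets with $\Theta_{{\rm c},t}(\omega)\subseteq\mathbb R^d$ closed, convex and containing $\mathcal L_t^\perp(\omega)$ for all $(\omega,t)$, and with $\{\omega:\Theta_{{\rm c},t}(\omega)\cap G\ne\emptyset\}\in\mathcal F_{t-1}$ for every open $G\subseteq\mathbb R^d$. Put $$\Theta_t:=\{\pi\in\mathbb R^d:\langle\pi,z\rangle\ge-1\ \ \forall z\in\mathcal S_t\}\cap\Theta_{{\rm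 c},t},\qquad \mathcal I_{{\rm arb},t}:=\{\pi\in\mathbb R^d:\langle\pi,z\rangle\ge0\ \ \forall z\in\mathcal S_t\}\setminus\mathcal L_t^\perp,$$ and let $\widehat\Theta_t:=\{y\in\mathbb R^d:\pi+\lambda y\in\Theta_t\ \ \forall\pi\in\Theta_t,\ \lambda\ge0\}$ be the recession cone of $\Theta_t$. A strategy is a predictable process $\pi=(\pi_t)_{t=1,\dots,T}$ (that is, $\pi_t$ is $\mathcal F_{t-1}$-measurable) with values in $\mathbb R^d$. We write $\pi\in\Theta$ (resp. $\pi\in\widehat\Theta$) if $\pi_t\in\Theta_t$ (resp. $\pi_t\in\widehat\Theta_t$) a.s. for all $t$. The wealth of $\pi$ from initial capital $v>0$ is $V^\pi_t(v)=v\prod_{k=1}^t(1+\langle\pi_k,R_k\rangle)$, and $V^\pi_t:=V^\pi_t(1)$. $L^0_+(\mathcal F_t)$ denotes the a.s. non-negative real-valued $\mathcal F_t$-measurable random variables. For $\xi\in L^0_+(\mathcal F_T)$ let $$v(\xi):=\inf\{v>0:\exists\,\pi\in\Theta\text{ with }V^\pi_T(v)\ge\xi\text{ a.s.}\},$$ and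 for $\zeta\in L^0_+(\mathcal F_t)$, $t=1,\dots,T$, let $${\rm v}_{t-1}(\zeta):=\operatorname{ess\,inf}\{x\in L^0_+(\mathcal F_{t-1}):\exists\,h\ \mathcal F_{t-1}\text{-measurable with }h\in\Theta_t\text{ a.s. and }x(1+\langle h,R_t\rangle)\ge\zeta\text{ a.s.}\},$$ both with the convention $\inf\emptyset=+\infty$. **Proposition.** The following are equivalent: 1. NA$_1$ holds: for every $\xi\in L^0_+(\mathcal F_T)$, $v(\xi)=0$ implies $\xi=0$ a.s.; 2. there is no strategy $\pi\in\widehat\Theta$ with $P(V^\pi_T\ge1)=1$ and $P(V^\pi_T>1)>0$; 3. for every $t=1,\dots,T$ and every $\zeta\in L^0_+(\mathcal F_t)$, ${\rm v}_{t-1}(\zeta)=0$ a.s. implies $\zeta=0$ a.s.; 4. $\mathcal I_{{\rm arb},t}\cap\widehat\Theta_t=\emptyset$ a.s., for all $t=1,\dots,T$; 5. $\widehat\Theta_t=\mathcal L_t^\perp$ a.s., for all $t=1,\dots,T$; 6. the set $\Theta_t\cap\mathcal L_t$ is a.s. bounded, for all $t=1,\dots,T$. Moreover, whenever $\Theta_t(\omega)\cap\mathcal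 L_t(\omega)$ is bounded it is compact. -/

import Mathlib

open MeasureTheory ProbabilityTheory
open scoped ENNReal RealInnerProductSpace

/-- The recession cone of a set `A`: all directions `y` such that `π + c • y` stays in `A`
for every `π ∈ A` and every `c ≥ 0`. -/
def recCone {E : Type*} [AddCommGroup E] [Module ℝ E] (A : Set E) : Set E :=
  {y | ∀ π ∈ A, ∀ c : ℝ, 0 ≤ c → π + c • y ∈ A}

/-- Measurability of a correspondence (set-valued map) `A` from `(Ω, m)` to `E`:
`{ω | A ω ∩ G ≠ ∅}` belongs to `m` for every open `G`. -/
def MeasurableCorr {Ω E : Type*} (m : MeasurableSpace Ω) [TopologicalSpace E]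
    (A : Ω → Set E) : Prop :=
  ∀ G : Set E, IsOpen G → MeasurableSet[m] {ω | (A ω ∩ G).Nonempty}

/-- `κ` is a regular version of the conditional distribution of `X` given the sub-σ-field `m`:
a probability kernel from `(Ω, m)` to `E` such that, for every `A ∈ m` and measurable `B`,
`P (A ∩ {X ∈ B}) = E[1_A κ(·, B)]`. -/
structure IsRegularCondLaw {Ω E : Type*} [MeasurableSpace Ω] [MeasurableSpace E]
    (P : Measure Ω) (m : MeasurableSpace Ω) (X : Ω → E) (κ : Kernel[m] Ω E) : Prop where
  isMarkov : ∀ ω, IsProbabilityMeasure (κ ω)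
  setLIntegral_eq : ∀ A : Set Ω, MeasurableSet[m] A → ∀ B : Set E, MeasurableSet B →
    ∫⁻ ω in A, κ ω B ∂P = P (A ∩ X ⁻¹' B)

/-- `g` is (a version of) the essential infimum, on `(Ω, m, P)`, of the family `X` of
nonnegative real random variables: the `P`-a.s. largest `m`-measurable `[0, ∞]`-valued function
that lies a.s. below each member of `X` (and `g = ∞` a.s. if `X` is empty). -/
structure IsEssInfFamily {Ω : Type*} [MeasurableSpace Ω] (P : Measure Ω) (m : MeasurableSpace Ω)
    (X : Set (Ω → ℝ)) (g : Ω → ℝ≥0∞) : Prop where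
  measurable : Measurable[m] g
  le : ∀ x ∈ X, ∀ᵐ ω ∂P, g ω ≤ ENNReal.ofReal (x ω)
  greatest : ∀ g' : Ω → ℝ≥0∞, Measurable[m] g' →
    (∀ x ∈ X, ∀ᵐ ω ∂P, g' ω ≤ ENNReal.ofReal (x ω)) → ∀ᵐ ω ∂P, g' ω ≤ g ω

/-- A multi-period market with `d` risky assets on a filtered probability space with dates
`0, …, T`, with random convex trading constraints. The trading periods are indexed by
`k : Fin T`; the period `k` runs from the date `k.castSucc` (the number `k`) to the date
`k.succ` (the number `k + 1`). Prices enter only through the returns `R`. -/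
structure ConstrainedMarket {Ω : Type*} [mΩ : MeasurableSpace Ω] (P : Measure Ω) (T d : ℕ) where
  /-- the filtration -/
  F : Filtration (Fin (T + 1)) mΩ
  /-- the initial σ-field is the trivial one completed by the null sets -/
  F_zero : ∀ A : Set Ω, MeasurableSet[F 0] A ↔ MeasurableSet[mΩ] A ∧ (P A = 0 ∨ P A = 1)
  /-- the returns -/
  R : Fin T → Ω → EuclideanSpace ℝ (Fin d)
  R_measurable : ∀ k, Measurable[F k.succ] (R k)
  R_ge : ∀ k i, ∀ᵐ ω ∂P, -1 ≤ R k ω i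
  /-- a regular version of the conditional distribution of the returns of a period, given the
  information at the beginning of that period -/
  condLaw : (k : Fin T) → Kernel[F k.castSucc] Ω (EuclideanSpace ℝ (Fin d))
  condLaw_spec : ∀ k, IsRegularCondLaw P (F k.castSucc) (R k) (condLaw k)
  /-- the trading constraints -/
  Θc : Fin T → Ω → Set (EuclideanSpace ℝ (Fin d))
  Θc_predictable : ∀ k, MeasurableCorr (F k.castSucc) (Θc k)
  Θc_convex : ∀ k ω, Convex ℝ (Θc k ω)
  Θc_closed : ∀ k ω, IsClosed (Θc k ω)
  /-- degenerate strategies are never forbidden -/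
  orthogonal_subset_Θc : ∀ k ω,
    (((Submodule.span ℝ (condLaw k ω).support)ᗮ : Submodule ℝ (EuclideanSpace ℝ (Fin d))) :
      Set (EuclideanSpace ℝ (Fin d))) ⊆ Θc k ω

namespace ConstrainedMarket

variable {Ω : Type*} [mΩ : MeasurableSpace Ω] {P : Measure Ω} {T d : ℕ}
  (M : ConstrainedMarket P T d)

/-- The conditional support of the returns of period `k`. -/
def condSupport (k : Fin T) (ω : Ω) : Set (EuclideanSpace ℝ (Fin d)) :=
  (M.condLaw k ω).support

/-- The linear span of the conditional support. -/
def L (k : Fin T) (ω : Ω) : Submodule ℝ (EuclideanSpace ℝ (Fin d)) :=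
  Submodule.span ℝ (M.condSupport k ω)

/-- The natural (admissibility) constraints. -/
def Θadm (k : Fin T) (ω : Ω) : Set (EuclideanSpace ℝ (Fin d)) :=
  {π | ∀ z ∈ M.condSupport k ω, -1 ≤ ⟪π, z⟫}

/-- The set of allowed positions. -/
def Θ (k : Fin T) (ω : Ω) : Set (EuclideanSpace ℝ (Fin d)) :=
  M.Θadm k ω ∩ M.Θc k ω

/-- The recession cone of the set of allowed positions. -/
def Θhat (k : Fin T) (ω : Ω) : Set (EuclideanSpace ℝ (Fin d)) :=
  recCone (M.Θ k ω)

/-- The period-`k` arbitrage set. -/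
def Iarb (k : Fin T) (ω : Ω) : Set (EuclideanSpace ℝ (Fin d)) :=
  {π | ∀ z ∈ M.condSupport k ω, 0 ≤ ⟪π, z⟫} \ ((M.L k ω)ᗮ : Submodule ℝ _)

/-- `h` belongs to `L⁰(𝓕; A)`, where `𝓕` is the σ-field at the beginning of period `k`:
`h` is `𝓕`-measurable and lies a.s. in the random set `A`. -/
def IsPositionIn (k : Fin T) (A : Ω → Set (EuclideanSpace ℝ (Fin d)))
    (h : Ω → EuclideanSpace ℝ (Fin d)) : Prop :=
  Measurable[M.F k.castSucc] h ∧ ∀ᵐ ω ∂P, h ω ∈ A ω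

/-- `π` is a predictable strategy with `π k ∈ A k` a.s. for every period `k`. -/
def IsStrategyIn (A : Fin T → Ω → Set (EuclideanSpace ℝ (Fin d)))
    (π : Fin T → Ω → EuclideanSpace ℝ (Fin d)) : Prop :=
  ∀ k, M.IsPositionIn k (A k) (π k)

/-- The wealth at date `t` of the strategy `π` (in fractions of wealth) started from `v`. -/
noncomputable def wealth (v : ℝ) (π : Fin T → Ω → EuclideanSpace ℝ (Fin d))
    (t : Fin (T + 1)) (ω : Ω) : ℝ :=
  v * ∏ k : Fin T with k.castSucc < t, (1 + ⟪π k ω, M.R k ω⟫)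

/-- `ξ ∈ L⁰₊(𝓕_t)`. -/
def IsClaim (t : Fin (T + 1)) (ξ : Ω → ℝ) : Prop :=
  Measurable[M.F t] ξ ∧ ∀ᵐ ω ∂P, 0 ≤ ξ ω

/-- The super-hedging value of `ξ`: the infimum, in `[0, ∞]`, of all `v > 0` from which some
allowed strategy super-replicates `ξ` at the date `T`. -/
noncomputable def superhedgingValue (ξ : Ω → ℝ) : ℝ≥0∞ :=
  sInf (ENNReal.ofReal '' {v : ℝ | 0 < v ∧ ∃ π, M.IsStrategyIn M.Θ π ∧
    ∀ᵐ ω ∂P, ξ ω ≤ M.wealth v π (Fin.last T) ω})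

/-- `g` is (a version of) the conditional super-hedging value of `ζ` at the beginning of
period `k`. -/
def IsCondSuperhedgingValue (k : Fin T) (ζ : Ω → ℝ) (g : Ω → ℝ≥0∞) : Prop :=
  IsEssInfFamily P (M.F k.castSucc)
    {x | M.IsClaim k.castSucc x ∧ ∃ h, M.IsPositionIn k (M.Θ k) h ∧
      ∀ᵐ ω ∂P, ζ ω ≤ x ω * (1 + ⟪h ω, M.R k ω⟫)} g

/-- No arbitrage of the first kind. -/
def NA1 : Prop :=
  ∀ ξ : Ω → ℝ, M.IsClaim (Fin.last T) ξ → M.superhedgingValue ξ = 0 → ∀ᵐ ω ∂P, ξ ω = 0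

/-- The strategy `π`, started from `1`, never ends below `1` and ends above `1` with positive
probability. -/
def IsArbitrage (π : Fin T → Ω → EuclideanSpace ℝ (Fin d)) : Prop :=
  P {ω | 1 ≤ M.wealth 1 π (Fin.last T) ω} = 1 ∧ 0 < P {ω | 1 < M.wealth 1 π (Fin.last T) ω}

/-- No arbitrage of the first kind in the single period `k`. -/
def NA1Period (k : Fin T) : Prop :=
  ∀ ζ : Ω → ℝ, M.IsClaim k.succ ζ → ∀ g : Ω → ℝ≥0∞, M.IsCondSuperhedgingValue k ζ g →
    (∀ᵐ ω ∂P, g ω = 0) → ∀ᵐ ω ∂P, ζ ω = 0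

end ConstrainedMarket

/-! For fixed `ω`, conditions 4, 5 and 6 agree by convex geometry. `Θ` is closed, convex and
contains `Lᗮ`, so `Θhat` is the sum of `Θhat ∩ L` and `Lᗮ`, and `Θhat ∩ L` is the recession cone of
`Θ ∩ L`, trivial exactly when that set is bounded. Moreover, dividing `-1 ≤ ⟪n • y, z⟫` by `n` shows
that directions in `Θhat` are nonnegative on the support.

If `Θ ∩ L` is bounded, the gains of all allowed positions share one finite bound depending on `ω`,
since only the component in `L` earns anything. Wealth then vanishes with the initial capital, which
gives 1 and 3. Under 5 a position in `Θhat` gains nothing, which gives 2.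

If 4 fails, there is a measurable `h` in `Θhat` whose gain is nonnegative and not a.s. zero. Holding
`h` in one period contradicts 2. As `(n + 1) • h` is allowed, its gain can be super-hedged from `1 /
(n + 1)`, contradicting 1 and 3. To find `h`, `Θ` and `Θhat` are written as common zeros of
countably many Carathéodory functions; convexity makes nearest-point projections measurable, and
these yield dense measurable selections. -/

/-! ### Measurable selections from convex zero sets. -/

section CaratheodoryZeros

open Filter Topology TopologicalSpace Metric

variable {Ω E : Type*} [NormedAddCommGroup E] [InnerProductSpace ℝ E] [FiniteDimensional ℝ E]

/-- Bounded approximate zeros of a sequence of nonnegative continuous functions accumulate at a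
common zero. -/
theorem exists_subseq_tendsto_zero_of_approx {ψ : ℕ → E → ℝ} (hc : ∀ n, Continuous (ψ n))
    (h0 : ∀ n y, 0 ≤ ψ n y) {q : E} {r : ℝ} {u : ℕ → E}
    (hu : ∀ j : ℕ, dist q (u j) < r + 1 / ((j : ℝ) + 1))
    (hψ : ∀ j : ℕ, ∀ i ≤ j, ψ i (u j) < 1 / ((j : ℝ) + 1))
    {ns : ℕ → ℕ} (hns : Tendsto ns atTop atTop) :
    ∃ z, ∃ φ : ℕ → ℕ, StrictMono φ ∧ Tendsto (fun j => u (ns (φ j))) atTop (𝓝 z) ∧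
      dist q z ≤ r ∧ ∀ i, ψ i z = 0 := by
  have hbdd : Bornology.IsBounded (closedBall q (r + 1)) := isBounded_closedBall
  have hmem : ∀ j, u (ns j) ∈ closedBall q (r + 1) := by
    intro j
    rw [mem_closedBall, dist_comm]
    have h1 : 1 / (((ns j : ℕ) : ℝ) + 1) ≤ 1 := by
      rw [div_le_one (by positivity)]
      have : (0 : ℝ) ≤ (ns j : ℝ) := by positivity
      linarith
    linarith [hu (ns j)]
  obtain ⟨z, -, φ, hφ, hz⟩ := tendsto_subseq_of_bounded hbdd hmem
  have hnφ : Tendsto (fun j => ns (φ j)) atTop atTop := hns.comp hφ.tendsto_atTop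
  have hsmall : Tendsto (fun j => 1 / (((ns (φ j) : ℕ) : ℝ) + 1)) atTop (𝓝 0) :=
    (tendsto_one_div_add_atTop_nhds_zero_nat (𝕜 := ℝ)).comp hnφ
  refine ⟨z, φ, hφ, hz, ?_, fun i => le_antisymm ?_ (h0 i z)⟩
  · refine le_of_tendsto_of_tendsto' (tendsto_const_nhds.dist hz) ?_
      (fun j => (hu (ns (φ j))).le)
    simpa using hsmall.const_add r
  · refine le_of_tendsto_of_tendsto (((hc i).tendsto z).comp hz) hsmall ?_
    filter_upwards [hnφ.eventually_ge_atTop i] with j hj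
    exact (hψ _ i hj).le

omit [InnerProductSpace ℝ E] [FiniteDimensional ℝ E] in
theorem isClosed_zeros {ψ : ℕ → E → ℝ} (hc : ∀ n, Continuous (ψ n)) :
    IsClosed {y | ∀ n, ψ n y = 0} := by
  simp only [Set.ofPred_forall]
  exact isClosed_iInter fun n => isClosed_eq (hc n) continuous_const

omit [InnerProductSpace ℝ E] [FiniteDimensional ℝ E] in
/-- A common zero is approximated by members of a dense sequence. -/
theorem exists_denseSeq_approx_zero [SeparableSpace E] {ψ : ℕ → E → ℝ}
    (hc : ∀ n, Continuous (ψ n)) {q z : E} {r : ℝ} (hz : ∀ n, ψ n z = 0) (hr : dist q z ≤ r)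
    (j : ℕ) : ∃ k, dist q (denseSeq E k) < r + 1 / ((j : ℝ) + 1) ∧
      ∀ i ≤ j, ψ i (denseSeq E k) < 1 / ((j : ℝ) + 1) := by
  have hpos : (0 : ℝ) < 1 / ((j : ℝ) + 1) := by positivity
  have h1 : ∀ᶠ y in 𝓝 z, dist q y < r + 1 / ((j : ℝ) + 1) :=
    (continuous_const.dist continuous_id).continuousAt.eventually_lt
      continuousAt_const (by simp only [id]; linarith)
  have h2 : ∀ᶠ y in 𝓝 z, ∀ i ∈ Finset.range (j + 1), ψ i y < 1 / ((j : ℝ) + 1) := by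
    rw [eventually_all_finset]
    intro i _
    exact (hc i).continuousAt.eventually_lt continuousAt_const (by rw [hz]; exact hpos)
  obtain ⟨k, hk1, hk2⟩ := (denseRange_denseSeq E).exists_mem_open isOpen_interior
    ⟨z, mem_interior_iff_mem_nhds.2 (h1.and h2)⟩ |>.imp fun k hk => interior_subset hk
  exact ⟨k, hk1, fun i hi => hk2 i (Finset.mem_range.2 (Nat.lt_succ_of_le hi))⟩

variable [MeasurableSpace Ω]

/-- The distance to the set of common zeros of a sequence of Carathéodory functions is
measurable. -/
theorem measurable_infDist_zeros {ψ : ℕ → Ω → E → ℝ} (hc : ∀ n ω, Continuous (ψ n ω))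
    (hm : ∀ n y, Measurable fun ω => ψ n ω y) (h0 : ∀ n ω y, 0 ≤ ψ n ω y)
    (hne : ∀ ω, {y | ∀ n, ψ n ω y = 0}.Nonempty) (q : E) :
    Measurable fun ω => infDist q {y | ∀ n, ψ n ω y = 0} := by
  refine measurable_of_Iic fun r => ?_
  -- By compactness of balls, a zero within `r` of `q` exists iff at each precision `1 / (j + 1)`
  -- some point of a fixed dense sequence is an approximate zero of the first `j + 1` functions.
  -- This involves only countably many events.
  have key : (fun ω => infDist q {y | ∀ n, ψ n ω y = 0}) ⁻¹' Set.Iic r =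
      ⋂ j : ℕ, ⋃ k : ℕ, {ω | dist q (denseSeq E k) < r + 1 / ((j : ℝ) + 1) ∧
        ∀ i ≤ j, ψ i ω (denseSeq E k) < 1 / ((j : ℝ) + 1)} := by
    ext ω
    simp only [Set.mem_preimage, Set.mem_Iic, Set.mem_iInter, Set.mem_iUnion]
    constructor
    · intro h j
      obtain ⟨z, hz, hd⟩ := (isClosed_zeros (hc · ω)).exists_infDist_eq_dist (hne ω) q
      exact exists_denseSeq_approx_zero (hc · ω) hz (hd ▸ h) j
    · intro h
      choose k hk using h
      obtain ⟨z, -, -, -, hd, hz⟩ := exists_subseq_tendsto_zero_of_approx (hc · ω) (h0 · ω)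
        (fun j => (hk j).1) (fun j => (hk j).2) tendsto_id
      exact (infDist_le_dist_of_mem (s := {y | ∀ n, ψ n ω y = 0}) hz).trans hd
  rw [key]
  refine MeasurableSet.iInter fun j => MeasurableSet.iUnion fun k => ?_
  simp only [Set.ofPred_and, Set.ofPred_forall]
  refine (MeasurableSet.const _).inter (MeasurableSet.iInter fun i => MeasurableSet.iInter
    fun _ => measurableSet_lt (hm i _) measurable_const)

omit [FiniteDimensional ℝ E] in
/-- Nearest points in convex sets are unique. -/
theorem Convex.eq_of_dist_le_infDist {A : Set E} (hA : Convex ℝ A) {q x y : E} (hx : x ∈ A)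
    (hy : y ∈ A) (hdx : dist q x ≤ infDist q A) (hdy : dist q y ≤ infDist q A) : x = y := by
  have hm : (1 / 2 : ℝ) • x + (1 / 2 : ℝ) • y ∈ A :=
    hA hx hy (by norm_num) (by norm_num) (by norm_num)
  have h1 := infDist_le_dist_of_mem (x := q) hm
  have h0 : 0 ≤ infDist q A := infDist_nonneg
  rw [dist_eq_norm] at *
  have hp := parallelogram_law_with_norm ℝ (q - x) (q - y)
  have e1 : q - ((1 / 2 : ℝ) • x + (1 / 2 : ℝ) • y) = (1 / 2 : ℝ) • ((q - x) + (q - y)) := by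
    module
  have e2 : (q - x) - (q - y) = y - x := by abel
  rw [e1, norm_smul, Real.norm_of_nonneg (by norm_num)] at h1
  rw [e2] at hp
  -- The midpoint is at least as far from `q` as the infimum, so the parallelogram law leaves no
  -- room for `y - x`.
  have hsq : ‖y - x‖ * ‖y - x‖ ≤ 0 := by
    nlinarith [norm_nonneg (q - x), norm_nonneg (q - y), norm_nonneg ((q - x) + (q - y))]
  have : ‖y - x‖ = 0 := by nlinarith [norm_nonneg (y - x)]
  exact (sub_eq_zero.1 (norm_eq_zero.1 this)).symm

/-- The projection of a point onto the set of common zeros of a sequence of Carathéodory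
functions, if convex, is measurable. -/
theorem exists_measurable_proj_zeros [MeasurableSpace E] [BorelSpace E] {ψ : ℕ → Ω → E → ℝ}
    (hc : ∀ n ω, Continuous (ψ n ω)) (hm : ∀ n y, Measurable fun ω => ψ n ω y)
    (h0 : ∀ n ω y, 0 ≤ ψ n ω y) (hne : ∀ ω, {y | ∀ n, ψ n ω y = 0}.Nonempty)
    (hconv : ∀ ω, Convex ℝ {y | ∀ n, ψ n ω y = 0}) (q : E) :
    ∃ f : Ω → E, Measurable f ∧ ∀ ω, (∀ n, ψ n ω (f ω) = 0) ∧
      dist q (f ω) = infDist q {y | ∀ n, ψ n ω y = 0} := by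
  classical
  choose f hfmem hf using fun ω => (isClosed_zeros (hc · ω)).exists_infDist_eq_dist (hne ω) q
  refine ⟨f, ?_, fun ω => ⟨hfmem ω, (hf ω).symm⟩⟩
  have hD := measurable_infDist_zeros hc hm h0 hne q
  set D : Ω → ℝ := fun ω => infDist q {y | ∀ n, ψ n ω y = 0}
  have hex (j : ℕ) (ω : Ω) : ∃ k, dist q (denseSeq E k) < D ω + 1 / ((j : ℝ) + 1) ∧
      ∀ i ≤ j, ψ i ω (denseSeq E k) < 1 / ((j : ℝ) + 1) :=
    exists_denseSeq_approx_zero (hc · ω) (hfmem ω) (hf ω).ge j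
  -- Taking the first admissible index keeps the approximations measurable. They converge because
  -- every subsequence has a further one tending to a nearest zero, and that zero is unique.
  refine measurable_of_tendsto_metrizable (f := fun j ω => denseSeq E (Nat.find (hex j ω)))
    (fun j => ?_) (tendsto_pi_nhds.2 fun ω => ?_)
  · refine (measurable_from_nat (f := denseSeq E)).comp (measurable_find (hex j) fun k => ?_)
    simp only [Set.ofPred_and, Set.ofPred_forall]
    exact (measurableSet_lt measurable_const (hD.add_const _)).inter
      (MeasurableSet.iInter fun i => MeasurableSet.iInter
        fun _ => measurableSet_lt (hm i _) measurable_const)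
  · refine tendsto_of_subseq_tendsto fun ns hns => ?_
    obtain ⟨z, φ, -, hz, hd, hz0⟩ := exists_subseq_tendsto_zero_of_approx (hc · ω) (h0 · ω)
      (fun j => (Nat.find_spec (hex j ω)).1) (fun j => (Nat.find_spec (hex j ω)).2) hns
    rw [(hconv ω).eq_of_dist_le_infDist (hfmem ω) hz0 (hf ω).ge hd]
    exact ⟨φ, hz⟩

/-- A Castaing representation of the set of common zeros of a sequence of Carathéodory functions,
if convex. -/
theorem exists_measurable_dense_zeros [MeasurableSpace E] [BorelSpace E] {ψ : ℕ → Ω → E → ℝ}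
    (hc : ∀ n ω, Continuous (ψ n ω)) (hm : ∀ n y, Measurable fun ω => ψ n ω y)
    (h0 : ∀ n ω y, 0 ≤ ψ n ω y) (hne : ∀ ω, {y | ∀ n, ψ n ω y = 0}.Nonempty)
    (hconv : ∀ ω, Convex ℝ {y | ∀ n, ψ n ω y = 0}) :
    ∃ f : ℕ → Ω → E, (∀ k, Measurable (f k)) ∧ (∀ k ω n, ψ n ω (f k ω) = 0) ∧
      ∀ ω, {y | ∀ n, ψ n ω y = 0} ⊆ closure (Set.range fun k => f k ω) := by
  choose f hfm hf using fun k => exists_measurable_proj_zeros hc hm h0 hne hconv (denseSeq E k)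
  refine ⟨f, hfm, fun k ω => (hf k ω).1, fun ω y hy => Metric.mem_closure_iff.2 fun ε hε => ?_⟩
  obtain ⟨k, hk⟩ := (denseRange_denseSeq E).exists_dist_lt y (half_pos hε)
  refine ⟨_, ⟨k, rfl⟩, ?_⟩
  have h1 : dist (denseSeq E k) (f k ω) ≤ dist (denseSeq E k) y :=
    (hf k ω).2.trans_le (infDist_le_dist_of_mem hy)
  calc dist y (f k ω) ≤ dist y (denseSeq E k) + dist (denseSeq E k) (f k ω) :=
        dist_triangle _ _ _
    _ < ε := by rw [dist_comm (denseSeq E k) y] at h1; linarith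

end CaratheodoryZeros

/-! ### Recession cones of closed convex sets. -/

section RecessionCone

open Filter Topology

variable {E : Type*} [NormedAddCommGroup E] [NormedSpace ℝ E]

/-- Convexity fills in the ray from `0`. A ray from another `π` is a limit of convex combinations of
`π` with ever farther points of the ray from `0`. Only countably many conditions remain, as
measurable selection requires. -/
theorem mem_recCone_iff_forall_nat {A : Set E} (hcl : IsClosed A) (hcv : Convex ℝ A)
    (h0 : (0 : E) ∈ A) {y : E} : y ∈ recCone A ↔ ∀ n : ℕ, (n : ℝ) • y ∈ A := by
  refine ⟨fun h n => by simpa using h 0 h0 n n.cast_nonneg, fun h π hπ c hc => ?_⟩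
  have hray : ∀ r : ℝ, 0 ≤ r → r • y ∈ A := by
    intro r hr
    obtain ⟨n, hn⟩ := exists_nat_gt r
    have hn0 : (0 : ℝ) < n := hr.trans_lt hn
    have := hcv.smul_mem_of_zero_mem h0 (h n) (t := r / n)
      ⟨by positivity, (div_le_one hn0).2 hn.le⟩
    rwa [smul_smul, div_mul_cancel₀ _ hn0.ne'] at this
  have ht : Tendsto (fun n : ℕ => 1 / ((n : ℝ) + 1)) atTop (𝓝 0) :=
    tendsto_one_div_add_atTop_nhds_zero_nat
  have hlim : Tendsto (fun n : ℕ => (1 - 1 / ((n : ℝ) + 1)) • π + c • y) atTop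
      (𝓝 ((1 - 0 : ℝ) • π + c • y)) :=
    ((tendsto_const_nhds.sub ht).smul_const π).add_const _
  rw [sub_zero, one_smul] at hlim
  refine hcl.mem_of_tendsto hlim (Eventually.of_forall fun n => ?_)
  have hn : (0 : ℝ) < (n : ℝ) + 1 := by positivity
  have h1 : 1 / ((n : ℝ) + 1) ≤ 1 := by
    rw [div_le_one hn]; linarith [n.cast_nonneg (α := ℝ)]
  have := hcv hπ (hray (((n : ℝ) + 1) * c) (by positivity)) (sub_nonneg.2 h1)
    (by positivity : (0 : ℝ) ≤ 1 / ((n : ℝ) + 1)) (by ring)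
  rwa [smul_smul, ← mul_assoc, one_div_mul_cancel hn.ne', one_mul] at this

theorem submodule_subset_recCone {A : Set E} (hcl : IsClosed A) (hcv : Convex ℝ A)
    {K : Submodule ℝ E} (hK : (K : Set E) ⊆ A) : (K : Set E) ⊆ recCone A := fun _ hy =>
  (mem_recCone_iff_forall_nat hcl hcv (hK K.zero_mem)).2 fun _ => hK (K.smul_mem _ hy)

theorem add_mem_recCone {A : Set E} {x y : E} (hx : x ∈ recCone A) (hy : y ∈ recCone A) :
    x + y ∈ recCone A := fun π hπ c hc => by
  rw [smul_add, ← add_assoc]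
  exact hy _ (hx π hπ c hc) c hc

/-- In finite dimensions a closed convex set is bounded iff its recession cone is trivial. -/
theorem isBounded_iff_recCone_subset [FiniteDimensional ℝ E] {A : Set E} (hcl : IsClosed A)
    (hcv : Convex ℝ A) (hne : A.Nonempty) : Bornology.IsBounded A ↔ recCone A ⊆ {0} := by
  refine ⟨fun hb y hy => ?_, fun h => ?_⟩
  · by_contra hy0
    obtain ⟨C, hC⟩ := isBounded_iff_forall_norm_le.1 hb
    obtain ⟨a, ha⟩ := hne
    have hpos : 0 < ‖y‖ := norm_pos_iff.2 hy0
    obtain ⟨n, hn⟩ := exists_nat_gt ((C + C) / ‖y‖)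
    rw [div_lt_iff₀ hpos] at hn
    have h1 := hC _ (hy a ha n n.cast_nonneg)
    have h2 : ‖(n : ℝ) • y‖ ≤ ‖a + (n : ℝ) • y‖ + ‖a‖ := by
      simpa using norm_sub_le (a + (n : ℝ) • y) a
    rw [norm_smul, Real.norm_natCast] at h2
    linarith [hC a ha]
  -- For a closed convex set every asymptotic direction is a recession direction.
  · rw [isBounded_iff_asymptoticCone_subset_singleton]
    refine fun v hv => h fun π hπ c hc => ?_
    rw [add_comm]
    exact hcv.smul_vadd_mem_of_isClosed_of_mem_asymptoticCone hcl hc hv hπ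

theorem recCone_inter_submodule [FiniteDimensional ℝ E] {A : Set E} (hcl : IsClosed A)
    (hcv : Convex ℝ A) (h0 : (0 : E) ∈ A) (K : Submodule ℝ E) :
    recCone (A ∩ K) = recCone A ∩ K := by
  ext y
  rw [Set.mem_inter_iff, mem_recCone_iff_forall_nat hcl hcv h0, mem_recCone_iff_forall_nat
    (hcl.inter K.closed_of_finiteDimensional) (hcv.inter K.convex) ⟨h0, K.zero_mem⟩]
  exact ⟨fun h => ⟨fun n => (h n).1, by simpa using (h 1).2⟩,
    fun h n => ⟨h.1 n, K.smul_mem _ h.2⟩⟩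

end RecessionCone

/-! ### Conditional laws and their supports. -/

namespace IsRegularCondLaw

open TopologicalSpace

variable {Ω E : Type*} {m : MeasurableSpace Ω} [mΩ : MeasurableSpace Ω] {P : Measure Ω}

theorem ae_eq_zero_of_measure_inter_eq_zero [MeasurableSpace E] {X : Ω → E} {κ : Kernel[m] Ω E}
    (h : IsRegularCondLaw P m X κ) (hm : m ≤ mΩ) {A : Set Ω} (hA : MeasurableSet[m] A)
    {B : Set E} (hB : MeasurableSet B) (h0 : P (A ∩ X ⁻¹' B) = 0) :
    ∀ᵐ ω ∂P, ω ∈ A → κ ω B = 0 := by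
  have hκ : Measurable[mΩ] fun ω => κ ω B := (κ.measurable_coe hB).mono hm le_rfl
  rw [← h.setLIntegral_eq A hA B hB, lintegral_eq_zero_iff hκ,
    Filter.EventuallyEq, ae_restrict_iff' (hm A hA)] at h0
  exact h0

/-- The complement of the support is a union of null sets from a countable basis. For each basic
`U`, the event `κ ω U = 0` is `m`-measurable, so `X` a.s. avoids `U` on it. -/
theorem ae_mem_support [TopologicalSpace E] [SecondCountableTopology E] [MeasurableSpace E]
    [BorelSpace E] {X : Ω → E} {κ : Kernel[m] Ω E} (h : IsRegularCondLaw P m X κ) (hm : m ≤ mΩ) :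
    ∀ᵐ ω ∂P, X ω ∈ (κ ω).support := by
  have hU : ∀ U ∈ countableBasis E, ∀ᵐ ω ∂P, ¬ (κ ω U = 0 ∧ X ω ∈ U) := by
    intro U hU
    have hUm : MeasurableSet U := ((isBasis_countableBasis E).isOpen hU).measurableSet
    have hA : MeasurableSet[m] {ω | κ ω U = 0} :=
      κ.measurable_coe hUm (measurableSet_singleton 0)
    have h1 := h.setLIntegral_eq _ hA U hUm
    rw [ae_iff]
    simp only [not_not]
    exact h1.symm.trans ((setLIntegral_congr_fun (hm _ hA) fun ω hω => hω).trans lintegral_zero)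
  rw [← ae_ball_iff (countable_countableBasis E)] at hU
  filter_upwards [hU] with ω hω
  by_contra hX
  obtain ⟨U, hUX, hU0⟩ := Measure.notMem_support_iff_exists.1 hX
  obtain ⟨V, hV, hXV, hVU⟩ := (isBasis_countableBasis E).mem_nhds_iff.1 hUX
  exact hω V hV ⟨measure_mono_null hVU hU0, hXV⟩

variable [NormedAddCommGroup E] [InnerProductSpace ℝ E] [SecondCountableTopology E]
  [MeasurableSpace E] [BorelSpace E]

/-- If `⟪h, X⟫ ≥ 0` a.s. for an `m`-measurable `h`, then a.s. `h` is nonnegative on the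
conditional support of `X`. -/
theorem ae_inner_nonneg_of_mem_support {X : Ω → E} {κ : Kernel[m] Ω E}
    (hκ : IsRegularCondLaw P m X κ) (hm : m ≤ mΩ) {h : Ω → E} (hh : Measurable[m] h)
    (h0 : ∀ᵐ ω ∂P, 0 ≤ ⟪h ω, X ω⟫) : ∀ᵐ ω ∂P, ∀ z ∈ (κ ω).support, 0 ≤ ⟪h ω, z⟫ := by
  -- The set of pairs with negative inner product is open, hence covered by countably many basic
  -- rectangles `V ×ˢ U`. This allows one exceptional null set for all `z`.
  have hVU : ∀ V ∈ countableBasis E, ∀ U ∈ countableBasis E,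
      (∀ y ∈ V, ∀ z ∈ U, ⟪y, z⟫ < 0) → ∀ᵐ ω ∂P, h ω ∈ V → κ ω U = 0 := by
    intro V hV U hU hneg
    refine hκ.ae_eq_zero_of_measure_inter_eq_zero hm
      (hh ((isBasis_countableBasis E).isOpen hV).measurableSet)
      ((isBasis_countableBasis E).isOpen hU).measurableSet ?_
    refine measure_mono_null ?_ (ae_iff.1 h0)
    rintro ω ⟨h1, h2⟩
    exact not_le.2 (hneg _ h1 _ h2)
  have hall : ∀ᵐ ω ∂P, ∀ V ∈ countableBasis E, ∀ U ∈ countableBasis E,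
      (∀ y ∈ V, ∀ z ∈ U, ⟪y, z⟫ < 0) → h ω ∈ V → κ ω U = 0 := by
    rw [ae_ball_iff (countable_countableBasis E)]
    intro V hV
    rw [ae_ball_iff (countable_countableBasis E)]
    intro U hU
    by_cases hneg : ∀ y ∈ V, ∀ z ∈ U, ⟪y, z⟫ < 0
    · filter_upwards [hVU V hV U hU hneg] with ω hω _ using hω
    · exact Filter.Eventually.of_forall fun ω hn => absurd hn hneg
  filter_upwards [hall] with ω hω z hz
  by_contra! hlt
  have hopen : IsOpen {p : E × E | ⟪p.1, p.2⟫ < 0} :=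
    isOpen_lt (continuous_fst.inner continuous_snd) continuous_const
  have hbasis := (isBasis_countableBasis E).prod (isBasis_countableBasis E)
  obtain ⟨W, ⟨V, hV, U, hU, rfl⟩, ⟨hhV, hzU⟩, hsub⟩ :=
    hbasis.exists_subset_of_mem_open (show (h ω, z) ∈ {p : E × E | ⟪p.1, p.2⟫ < 0} from hlt) hopen
  have := hω V hV U hU (fun y hy z hz => hsub (Set.mk_mem_prod hy hz)) hhV
  exact (Measure.mem_support_iff_forall z).1 hz U
    (((isBasis_countableBasis E).isOpen hU).mem_nhds hzU) |>.ne' this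

end IsRegularCondLaw

/-! ### A Carathéodory function for the admissibility constraint. -/

section Shortfall

variable {Ω E : Type*} [NormedAddCommGroup E] [InnerProductSpace ℝ E]
  [SecondCountableTopology E] [MeasurableSpace E] [BorelSpace E]

/-- The mean truncated shortfall of `⟪y, ·⟫` below `-1`. -/
noncomputable def meanShortfall (μ : Measure E) (y : E) : ℝ :=
  ∫ z, min 1 (max 0 (-1 - ⟪y, z⟫)) ∂μ

omit [MeasurableSpace E] [BorelSpace E] [SecondCountableTopology E] in
theorem continuous_shortfall :
    Continuous fun p : E × E => min 1 (max 0 (-1 - ⟪p.1, p.2⟫)) := by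
  fun_prop

omit [MeasurableSpace E] [BorelSpace E] [SecondCountableTopology E] in
theorem norm_shortfall_le (y z : E) : ‖min 1 (max 0 (-1 - ⟪y, z⟫))‖ ≤ 1 := by
  rw [Real.norm_of_nonneg (le_min zero_le_one (le_max_left _ _))]
  exact min_le_left _ _

omit [SecondCountableTopology E] in
-- Truncation at `1` provides a dominating constant, so no moments of `μ` are needed.
theorem continuous_meanShortfall (μ : Measure E) [IsFiniteMeasure μ] :
    Continuous (meanShortfall μ) :=
  continuous_of_dominated (bound := fun _ => 1)
    (fun y => (continuous_shortfall.comp (Continuous.prodMk_right y)).aestronglyMeasurable)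
    (fun y => Filter.Eventually.of_forall (norm_shortfall_le y)) (integrable_const _)
    (Filter.Eventually.of_forall fun z =>
      continuous_shortfall.comp (Continuous.prodMk_left z))

omit [SecondCountableTopology E] [BorelSpace E] in
theorem meanShortfall_nonneg (μ : Measure E) (y : E) : 0 ≤ meanShortfall μ y :=
  integral_nonneg fun _ => le_min zero_le_one (le_max_left _ _)

omit [SecondCountableTopology E] in
theorem measurable_meanShortfall {m : MeasurableSpace Ω} (κ : Kernel[m] Ω E) (y : E) :
    Measurable[m] fun ω => meanShortfall (κ ω) y :=
  (StronglyMeasurable.integral_kernel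
    (continuous_shortfall.comp (Continuous.prodMk_right y)).stronglyMeasurable).measurable

/-- The half-space `-1 ≤ ⟪y, z⟫` is closed, so it has full measure iff it contains the support. -/
theorem meanShortfall_eq_zero_iff (μ : Measure E) [IsFiniteMeasure μ] (y : E) :
    meanShortfall μ y = 0 ↔ ∀ z ∈ μ.support, -1 ≤ ⟪y, z⟫ := by
  have hcont : Continuous fun z : E => min 1 (max 0 (-1 - ⟪y, z⟫)) :=
    continuous_shortfall.comp (Continuous.prodMk_right y)
  have hint : Integrable (fun z : E => min 1 (max 0 (-1 - ⟪y, z⟫))) μ :=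
    (integrable_const (1 : ℝ)).mono' hcont.aestronglyMeasurable
      (Filter.Eventually.of_forall (norm_shortfall_le y))
  have hz (z : E) : min 1 (max 0 (-1 - ⟪y, z⟫)) = 0 ↔ -1 ≤ ⟪y, z⟫ := by
    constructor
    · intro h
      by_contra! hlt
      have : 0 < min 1 (max 0 (-1 - ⟪y, z⟫)) :=
        lt_min one_pos (lt_max_of_lt_right (by linarith))
      exact this.ne' h
    · intro h
      rw [max_eq_left (by linarith), min_eq_right zero_le_one]
  have hclosed : IsClosed {z : E | -1 ≤ ⟪y, z⟫} :=
    isClosed_le continuous_const (continuous_const.inner continuous_id)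
  rw [meanShortfall, integral_eq_zero_iff_of_nonneg
    (f := fun z => min 1 (max 0 (-1 - ⟪y, z⟫)))
    (fun _ => le_min zero_le_one (le_max_left _ _)) hint]
  constructor
  · intro h
    refine Measure.support_subset_of_isClosed hclosed ?_
    filter_upwards [h] with z h1 using (hz z).1 h1
  · intro h
    filter_upwards [Measure.support_mem_ae (μ := μ)] with z h1 using (hz z).2 (h z h1)

end Shortfall

theorem MeasurableCorr.measurable_infDist {Ω E : Type*} {m : MeasurableSpace Ω}
    [PseudoMetricSpace E] {A : Ω → Set E} (hA : MeasurableCorr m A)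
    (hne : ∀ ω, (A ω).Nonempty) (x : E) : Measurable[m] fun ω => Metric.infDist x (A ω) := by
  refine measurable_of_Iio fun r => ?_
  convert hA (Metric.ball x r) Metric.isOpen_ball using 1
  ext ω
  simp only [Set.mem_preimage, Set.mem_Iio, Metric.infDist_lt_iff (hne ω)]
  exact exists_congr fun y => and_congr Iff.rfl (by rw [Metric.mem_ball, dist_comm])

/-! ### Geometry of the allowed positions for fixed `ω`. -/

namespace ConstrainedMarket

variable {Ω : Type*} [mΩ : MeasurableSpace Ω] {P : Measure Ω} {T d : ℕ}
  (M : ConstrainedMarket P T d)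

section Pointwise

variable (k : Fin T) (ω : Ω)

theorem mem_orthogonal_L_iff {y : EuclideanSpace ℝ (Fin d)} :
    y ∈ (M.L k ω)ᗮ ↔ ∀ z ∈ M.condSupport k ω, ⟪y, z⟫ = 0 := by
  rw [Submodule.mem_orthogonal']
  refine ⟨fun h z hz => h z (Submodule.subset_span hz), fun h u hu => ?_⟩
  induction hu using Submodule.span_induction with
  | mem z hz => exact h z hz
  | zero => exact inner_zero_right _
  | add u v _ _ hu hv => rw [inner_add_right, hu, hv, add_zero]
  | smul c u _ hu => rw [inner_smul_right, hu, mul_zero]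

theorem isClosed_Θ : IsClosed (M.Θ k ω) := by
  refine IsClosed.inter ?_ (M.Θc_closed k ω)
  simp only [Θadm, Set.ofPred_forall]
  exact isClosed_iInter fun z => isClosed_iInter fun _ =>
    isClosed_le continuous_const (continuous_id.inner continuous_const)

theorem convex_Θ : Convex ℝ (M.Θ k ω) := by
  refine Convex.inter (fun x hx y hy a b ha hb hab z hz => ?_) (M.Θc_convex k ω)
  rw [inner_add_left, real_inner_smul_left, real_inner_smul_left]
  nlinarith [hx z hz, hy z hz]

theorem orthogonal_subset_Θ :
    (((M.L k ω)ᗮ : Submodule ℝ (EuclideanSpace ℝ (Fin d))) : Set _) ⊆ M.Θ k ω :=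
  fun y hy => ⟨fun z hz => by rw [(M.mem_orthogonal_L_iff k ω).1 hy z hz]; norm_num,
    M.orthogonal_subset_Θc k ω hy⟩

theorem zero_mem_Θ : 0 ∈ M.Θ k ω := M.orthogonal_subset_Θ k ω (Submodule.zero_mem _)

theorem orthogonal_subset_Θhat :
    (((M.L k ω)ᗮ : Submodule ℝ (EuclideanSpace ℝ (Fin d))) : Set _) ⊆ M.Θhat k ω :=
  submodule_subset_recCone (M.isClosed_Θ k ω) (M.convex_Θ k ω) (M.orthogonal_subset_Θ k ω)

theorem mem_Θhat_iff {y : EuclideanSpace ℝ (Fin d)} :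
    y ∈ M.Θhat k ω ↔ ∀ n : ℕ, (n : ℝ) • y ∈ M.Θ k ω :=
  mem_recCone_iff_forall_nat (M.isClosed_Θ k ω) (M.convex_Θ k ω) (M.zero_mem_Θ k ω)

theorem zero_mem_Θhat : 0 ∈ M.Θhat k ω := M.orthogonal_subset_Θhat k ω (Submodule.zero_mem _)

theorem convex_Θhat : Convex ℝ (M.Θhat k ω) := by
  intro x hx y hy a b ha hb hab
  rw [mem_Θhat_iff] at *
  intro n
  rw [smul_add, smul_comm _ a, smul_comm _ b]
  exact M.convex_Θ k ω (hx n) (hy n) ha hb hab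

theorem inner_nonneg_of_mem_Θhat {y : EuclideanSpace ℝ (Fin d)} (hy : y ∈ M.Θhat k ω) :
    ∀ z ∈ M.condSupport k ω, 0 ≤ ⟪y, z⟫ := by
  intro z hz
  by_contra! hlt
  obtain ⟨n, hn⟩ := exists_nat_gt (1 / -⟪y, z⟫)
  rw [div_lt_iff₀ (by linarith)] at hn
  have := ((M.mem_Θhat_iff k ω).1 hy n).1 z hz
  rw [real_inner_smul_left] at this
  linarith

theorem Iarb_inter_Θhat_eq_empty_iff : M.Iarb k ω ∩ M.Θhat k ω = ∅ ↔
    M.Θhat k ω = ((M.L k ω)ᗮ : Submodule ℝ (EuclideanSpace ℝ (Fin d))) := by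
  constructor
  · intro h
    refine Set.Subset.antisymm (fun y hy => ?_) (M.orthogonal_subset_Θhat k ω)
    by_contra hn
    exact (h ▸ ⟨⟨M.inner_nonneg_of_mem_Θhat k ω hy, hn⟩, hy⟩ :
      y ∈ (∅ : Set (EuclideanSpace ℝ (Fin d))))
  · intro h
    rw [h]
    exact Set.eq_empty_of_forall_notMem fun y hy => hy.1.2 hy.2

/-- `Θhat` is closed under addition and contains `Lᗮ`, so projecting onto `L` keeps a direction in
`Θhat`. Hence only `Θhat ∩ L`, the recession cone of `Θ ∩ L`, decides. -/
theorem Θhat_eq_orthogonal_iff_isBounded :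
    M.Θhat k ω = ((M.L k ω)ᗮ : Submodule ℝ (EuclideanSpace ℝ (Fin d))) ↔
      Bornology.IsBounded (M.Θ k ω ∩ M.L k ω) := by
  rw [isBounded_iff_recCone_subset
    ((M.isClosed_Θ k ω).inter (M.L k ω).closed_of_finiteDimensional)
    ((M.convex_Θ k ω).inter (M.L k ω).convex) ⟨0, M.zero_mem_Θ k ω, (M.L k ω).zero_mem⟩,
    recCone_inter_submodule (M.isClosed_Θ k ω) (M.convex_Θ k ω) (M.zero_mem_Θ k ω)]
  constructor
  · rintro h y ⟨hy, hyL⟩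
    have hy' : y ∈ (M.L k ω)ᗮ := by
      rw [← SetLike.mem_coe, ← h]; exact hy
    have : y ∈ M.L k ω ⊓ (M.L k ω)ᗮ := ⟨hyL, hy'⟩
    rwa [Submodule.inf_orthogonal_eq_bot, Submodule.mem_bot] at this
  · intro h
    refine Set.Subset.antisymm (fun y hy => ?_) (M.orthogonal_subset_Θhat k ω)
    have hsub := (M.L k ω).sub_starProjection_mem_orthogonal y
    have hproj : (M.L k ω).starProjection y = 0 := by
      refine h ⟨?_, (M.L k ω).starProjection_apply_mem y⟩
      have := add_mem_recCone hy
        (M.orthogonal_subset_Θhat k ω ((M.L k ω)ᗮ.neg_mem hsub))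
      rwa [neg_sub, add_sub_cancel] at this
    rwa [hproj, sub_zero] at hsub

theorem isCompact_Θ_inter_L (h : Bornology.IsBounded (M.Θ k ω ∩ M.L k ω)) :
    IsCompact (M.Θ k ω ∩ M.L k ω) :=
  Metric.isCompact_of_isClosed_isBounded
    ((M.isClosed_Θ k ω).inter (M.L k ω).closed_of_finiteDimensional) h

theorem starProjection_L_mem_Θ {y : EuclideanSpace ℝ (Fin d)} (hy : y ∈ M.Θ k ω) :
    (M.L k ω).starProjection y ∈ M.Θ k ω ∩ M.L k ω := by
  refine ⟨?_, (M.L k ω).starProjection_apply_mem y⟩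
  have := M.orthogonal_subset_Θhat k ω
    ((M.L k ω)ᗮ.neg_mem ((M.L k ω).sub_starProjection_mem_orthogonal y)) y hy 1 zero_le_one
  rwa [one_smul, neg_sub, add_sub_cancel] at this

/-- Under boundedness of `Θ ∩ L`, the gains of allowed positions in a direction of the support
are bounded. -/
theorem exists_forall_mem_Θ_abs_inner_le (h : Bornology.IsBounded (M.Θ k ω ∩ M.L k ω))
    {z : EuclideanSpace ℝ (Fin d)} (hz : z ∈ M.condSupport k ω) :
    ∃ C : ℝ, ∀ y ∈ M.Θ k ω, |⟪y, z⟫| ≤ C := by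
  obtain ⟨C, hC⟩ := isBounded_iff_forall_norm_le.1 h
  refine ⟨C * ‖z‖, fun y hy => ?_⟩
  have horth : ⟪y - (M.L k ω).starProjection y, z⟫ = 0 :=
    (M.mem_orthogonal_L_iff k ω).1 ((M.L k ω).sub_starProjection_mem_orthogonal y) z hz
  rw [inner_sub_left, sub_eq_zero] at horth
  rw [horth]
  exact (abs_real_inner_le_norm _ _).trans
    (mul_le_mul_of_nonneg_right (hC _ (M.starProjection_L_mem_Θ k ω hy)) (norm_nonneg z))

end Pointwise

/-! ### Measurable selections of positions and arbitrage directions. -/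

section Measurability

variable (k : Fin T)

/-- A Carathéodory function whose zeros are the allowed positions. -/
noncomputable def constraintGap (ω : Ω) (y : EuclideanSpace ℝ (Fin d)) : ℝ :=
  meanShortfall (M.condLaw k ω) y + Metric.infDist y (M.Θc k ω)

theorem constraintGap_nonneg (ω : Ω) (y : EuclideanSpace ℝ (Fin d)) :
    0 ≤ M.constraintGap k ω y :=
  add_nonneg (meanShortfall_nonneg _ _) Metric.infDist_nonneg

theorem nonempty_Θc (ω : Ω) : (M.Θc k ω).Nonempty := ⟨0, (M.zero_mem_Θ k ω).2⟩

theorem constraintGap_eq_zero_iff (ω : Ω) (y : EuclideanSpace ℝ (Fin d)) :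
    M.constraintGap k ω y = 0 ↔ y ∈ M.Θ k ω := by
  have := (M.condLaw_spec k).isMarkov ω
  rw [constraintGap, add_eq_zero_iff_of_nonneg (meanShortfall_nonneg _ _) Metric.infDist_nonneg,
    meanShortfall_eq_zero_iff, ← (M.Θc_closed k ω).mem_iff_infDist_zero (M.nonempty_Θc k ω)]
  rfl

theorem continuous_constraintGap (ω : Ω) : Continuous (M.constraintGap k ω) := by
  have := (M.condLaw_spec k).isMarkov ω
  exact (continuous_meanShortfall _).add (Metric.continuous_infDist_pt _)

theorem measurable_constraintGap (y : EuclideanSpace ℝ (Fin d)) :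
    Measurable[M.F k.castSucc] fun ω => M.constraintGap k ω y := by
  exact Measurable.add (m := M.F k.castSucc) (measurable_meanShortfall (M.condLaw k) y)
    ((M.Θc_predictable k).measurable_infDist (M.nonempty_Θc k) y)

theorem setOf_constraintGap_eq_zero (ω : Ω) :
    {y | ∀ _ : ℕ, M.constraintGap k ω y = 0} = M.Θ k ω := by
  ext y
  simp [constraintGap_eq_zero_iff]

theorem setOf_constraintGap_smul_eq_zero (ω : Ω) :
    {y | ∀ n : ℕ, M.constraintGap k ω ((n : ℝ) • y) = 0} = M.Θhat k ω := by
  ext y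
  simp [constraintGap_eq_zero_iff, mem_Θhat_iff]

theorem exists_measurable_dense_Θ : ∃ f : ℕ → Ω → EuclideanSpace ℝ (Fin d),
    (∀ n, Measurable[M.F k.castSucc] (f n)) ∧ (∀ n ω, f n ω ∈ M.Θ k ω) ∧
      ∀ ω, M.Θ k ω ⊆ closure (Set.range fun n => f n ω) := by
  obtain ⟨f, hf, hf0, hd⟩ := @exists_measurable_dense_zeros Ω (EuclideanSpace ℝ (Fin d)) _ _ _
    (M.F k.castSucc) _ _ (fun _ => M.constraintGap k)
    (fun _ => M.continuous_constraintGap k) (fun _ => M.measurable_constraintGap k)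
    (fun _ => M.constraintGap_nonneg k)
    (fun ω => by rw [setOf_constraintGap_eq_zero]; exact ⟨0, M.zero_mem_Θ k ω⟩)
    (fun ω => by rw [setOf_constraintGap_eq_zero]; exact M.convex_Θ k ω)
  refine ⟨f, hf, fun n ω => (M.constraintGap_eq_zero_iff k ω _).1 (hf0 n ω 0), fun ω => ?_⟩
  rw [← setOf_constraintGap_eq_zero]
  exact hd ω

theorem exists_measurable_dense_Θhat : ∃ f : ℕ → Ω → EuclideanSpace ℝ (Fin d),
    (∀ n, Measurable[M.F k.castSucc] (f n)) ∧ (∀ n ω, f n ω ∈ M.Θhat k ω) ∧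
      ∀ ω, M.Θhat k ω ⊆ closure (Set.range fun n => f n ω) := by
  obtain ⟨f, hf, hf0, hd⟩ := @exists_measurable_dense_zeros Ω (EuclideanSpace ℝ (Fin d)) _ _ _
    -- The `n`-th function tests whether the dilation `n • y` is allowed; together they test
    -- membership in the recession cone.
    (M.F k.castSucc) _ _ (fun n ω y => M.constraintGap k ω ((n : ℝ) • y))
    (fun n ω => (M.continuous_constraintGap k ω).comp (continuous_const_smul _))
    (fun _ _ => M.measurable_constraintGap k _)
    (fun _ _ _ => M.constraintGap_nonneg k _ _)
    (fun ω => by rw [setOf_constraintGap_smul_eq_zero]; exact ⟨0, M.zero_mem_Θhat k ω⟩)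
    (fun ω => by rw [setOf_constraintGap_smul_eq_zero]; exact M.convex_Θhat k ω)
  refine ⟨f, hf, fun n ω => ?_, fun ω => ?_⟩
  · rw [← setOf_constraintGap_smul_eq_zero]
    exact hf0 n ω
  · rw [← setOf_constraintGap_smul_eq_zero]
    exact hd ω

theorem ae_R_mem_condSupport : ∀ᵐ ω ∂P, M.R k ω ∈ M.condSupport k ω :=
  (M.condLaw_spec k).ae_mem_support (M.F.le _)

theorem ae_mem_orthogonal_L_of_ae_inner_eq_zero {h : Ω → EuclideanSpace ℝ (Fin d)}
    (hm : Measurable[M.F k.castSucc] h) (h0 : ∀ᵐ ω ∂P, ⟪h ω, M.R k ω⟫ = 0) :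
    ∀ᵐ ω ∂P, h ω ∈ (M.L k ω)ᗮ := by
  have h1 := (M.condLaw_spec k).ae_inner_nonneg_of_mem_support (M.F.le _) hm
    (h0.mono fun ω hω => hω.ge)
  have h2 := (M.condLaw_spec k).ae_inner_nonneg_of_mem_support (M.F.le _) hm.neg
    (h0.mono fun ω hω => by simp [hω])
  filter_upwards [h1, h2] with ω h1 h2
  refine (M.mem_orthogonal_L_iff k ω).2 fun z hz => le_antisymm ?_ (h1 z hz)
  have := h2 z hz
  rw [Pi.neg_apply, inner_neg_left] at this
  linarith

/-- If one-period arbitrage directions exist with positive probability, one of them can be chosen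
in a measurable way. -/
theorem exists_measurable_arbitrage_direction
    (hk : ¬ ∀ᵐ ω ∂P, M.Iarb k ω ∩ M.Θhat k ω = ∅) :
    ∃ h : Ω → EuclideanSpace ℝ (Fin d), Measurable[M.F k.castSucc] h ∧
      (∀ ω, h ω ∈ M.Θhat k ω) ∧ (∀ᵐ ω ∂P, 0 ≤ ⟪h ω, M.R k ω⟫) ∧
      ¬ ∀ᵐ ω ∂P, ⟪h ω, M.R k ω⟫ = 0 := by
  obtain ⟨f, hf, hmem, hd⟩ := M.exists_measurable_dense_Θhat k
  -- If no member of the dense family works, each has zero gain and so lies a.s. in the closed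
  -- subspace `Lᗮ`; then so does all of `Θhat`.
  by_contra! hcon
  refine hk ?_
  have hall : ∀ᵐ ω ∂P, ∀ n, f n ω ∈ (M.L k ω)ᗮ := by
    refine ae_all_iff.2 fun n => M.ae_mem_orthogonal_L_of_ae_inner_eq_zero k (hf n)
      (hcon (f n) (hf n) (hmem n) ?_)
    filter_upwards [M.ae_R_mem_condSupport k] with ω hω
    exact M.inner_nonneg_of_mem_Θhat k ω (hmem n ω) _ hω
  filter_upwards [hall] with ω hω
  rw [Iarb_inter_Θhat_eq_empty_iff]
  refine Set.Subset.antisymm ((hd ω).trans (closure_minimal ?_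
    ((M.L k ω)ᗮ).closed_of_finiteDimensional)) (M.orthogonal_subset_Θhat k ω)
  rintro _ ⟨n, rfl⟩
  exact hω n

end Measurability

end ConstrainedMarket

/-! ### Essential infima of majorants. -/

theorem ENNReal.eq_zero_of_forall_le_ofReal_one_div {a : ℝ≥0∞}
    (h : ∀ n : ℕ, a ≤ ENNReal.ofReal (1 / ((n : ℝ) + 1))) : a = 0 := by
  refine le_antisymm (ge_of_tendsto' (x := Filter.atTop) ?_ h) zero_le
  rw [← ENNReal.ofReal_zero]
  exact ENNReal.tendsto_ofReal tendsto_one_div_add_atTop_nhds_zero_nat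

/-- A nonnegative random variable is a.s. zero if the only nonnegative `m`-measurable function
below all its `m`-measurable real majorants is zero. -/
theorem ae_eq_zero_of_isEssInfFamily_majorants {Ω : Type*}
    {m : MeasurableSpace Ω} [mΩ : MeasurableSpace Ω] {P : Measure Ω} [IsProbabilityMeasure P] (hm : m ≤ mΩ)
    {X : Set (Ω → ℝ)} {g : Ω → ℝ≥0∞}
    (hX : ∀ x ∈ X, Measurable[m] x) (hg : IsEssInfFamily P m X g) (hg0 : ∀ᵐ ω ∂P, g ω = 0)
    {Y : Ω → ℝ} (hY : Measurable Y) (hY0 : ∀ᵐ ω ∂P, 0 ≤ Y ω)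
    (hYX : ∀ x ∈ X, ∀ᵐ ω ∂P, Y ω ≤ x ω) : ∀ᵐ ω ∂P, Y ω = 0 := by
  have hbound : ∀ {f : Ω → ℝ}, (∀ᵐ ω ∂P, 0 ≤ f ω) → ∀ᵐ ω ∂P, ‖min (f ω) 1‖ ≤ (1 : ℝ) := by
    intro f hf
    filter_upwards [hf] with ω hω
    rw [Real.norm_of_nonneg (le_min hω zero_le_one)]
    exact min_le_right _ _
  have hint : Integrable (fun ω => min (Y ω) 1) P :=
    (integrable_const (1 : ℝ)).mono' (hY.min measurable_const).aestronglyMeasurable (hbound hY0)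
  -- `Y` need not be `m`-measurable, but its truncated conditional expectation is, and it still lies
  -- below every majorant, hence below `g = 0`.
  have hle : ∀ᵐ ω ∂P, (P[fun ω => min (Y ω) 1 | m]) ω ≤ 0 := by
    have hmeas : Measurable[m] fun ω => ENNReal.ofReal ((P[fun ω => min (Y ω) 1 | m]) ω) :=
      ENNReal.measurable_ofReal.comp stronglyMeasurable_condExp.measurable
    have hgreatest := hg.greatest _ hmeas fun x hx => by
      have hx0 : ∀ᵐ ω ∂P, 0 ≤ x ω := by
        filter_upwards [hY0, hYX x hx] with ω h1 h2 using h1.trans h2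
      have hxm : StronglyMeasurable[m] fun ω => min (x ω) 1 :=
        (Measurable.min (mδ := m) (hX x hx)
          (@measurable_const _ _ _ m 1)).stronglyMeasurable
      have hxint : Integrable (fun ω => min (x ω) 1) P :=
        (integrable_const (1 : ℝ)).mono' (hxm.mono hm).aestronglyMeasurable (hbound hx0)
      have hmono := condExp_mono (m := m) hint hxint
        ((hYX x hx).mono fun ω hω => min_le_min_right 1 hω)
      rw [condExp_of_stronglyMeasurable hm hxm hxint] at hmono
      filter_upwards [hmono] with ω hω
      exact ENNReal.ofReal_le_ofReal (hω.trans (min_le_left _ _))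
    filter_upwards [hg0, hgreatest] with ω h1 h2
    rw [h1, nonpos_iff_eq_zero, ENNReal.ofReal_eq_zero] at h2
    exact h2
  have hnonneg : 0 ≤ᵐ[P] fun ω => min (Y ω) 1 :=
    hY0.mono fun ω hω => le_min hω zero_le_one
  have hzero : ∫ ω, min (Y ω) 1 ∂P = 0 := by
    refine le_antisymm ?_ (integral_nonneg_of_ae hnonneg)
    rw [← integral_condExp hm]
    exact integral_nonpos_of_ae hle
  filter_upwards [(integral_eq_zero_iff_of_nonneg_ae hnonneg hint).1 hzero] with ω hω
  rcases min_choice (Y ω) 1 with h1 | h1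
  · exact h1.symm.trans hω
  · exact absurd (h1.symm.trans hω) one_ne_zero

/-! ### From an arbitrage direction to failure of each no-arbitrage condition. -/

namespace ConstrainedMarket

variable {Ω : Type*} [mΩ : MeasurableSpace Ω] {P : Measure Ω} {T d : ℕ}
  (M : ConstrainedMarket P T d)

theorem wealth_last (v : ℝ) (π : Fin T → Ω → EuclideanSpace ℝ (Fin d)) (ω : Ω) :
    M.wealth v π (Fin.last T) ω = v * ∏ k, (1 + ⟪π k ω, M.R k ω⟫) := by
  rw [wealth, Finset.filter_true_of_mem fun k _ => k.castSucc_lt_last]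

section SinglePeriod

variable (k : Fin T) (h : Ω → EuclideanSpace ℝ (Fin d))

theorem wealth_last_single (v : ℝ) (ω : Ω) :
    M.wealth v (Pi.single k h) (Fin.last T) ω = v * (1 + ⟪h ω, M.R k ω⟫) := by
  rw [wealth_last, Finset.prod_eq_single k (fun j _ hj => by simp [Pi.single_eq_of_ne hj])
    (fun hk => absurd (Finset.mem_univ k) hk), Pi.single_eq_same]

variable {k h}

theorem isStrategyIn_single {A : Fin T → Ω → Set (EuclideanSpace ℝ (Fin d))}
    (hA : ∀ j ω, 0 ∈ A j ω) (hh : M.IsPositionIn k (A k) h) :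
    M.IsStrategyIn A (Pi.single k h) := by
  intro j
  rcases eq_or_ne j k with rfl | hj
  · rwa [Pi.single_eq_same]
  · rw [Pi.single_eq_of_ne hj]
    exact ⟨@measurable_const _ _ _ (M.F j.castSucc) 0, Filter.Eventually.of_forall (hA j)⟩

theorem isPositionIn_smul (hm : Measurable[M.F k.castSucc] h) (hmem : ∀ ω, h ω ∈ M.Θhat k ω)
    {c : ℝ} (hc : 0 ≤ c) : M.IsPositionIn k (M.Θ k) (fun ω => c • h ω) := by
  refine ⟨hm.const_smul c, Filter.Eventually.of_forall fun ω => ?_⟩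
  simpa using hmem ω 0 (M.zero_mem_Θ k ω) c hc

theorem measurable_gain (hm : Measurable[M.F k.castSucc] h) :
    Measurable[M.F k.succ] fun ω => ⟪h ω, M.R k ω⟫ :=
  Measurable.inner
    (hm.mono (M.F.mono k.castSucc_lt_succ.le) le_rfl) (M.R_measurable k)

theorem isClaim_gain (hm : Measurable[M.F k.castSucc] h)
    (h0 : ∀ᵐ ω ∂P, 0 ≤ ⟪h ω, M.R k ω⟫) : M.IsClaim k.succ fun ω => ⟪h ω, M.R k ω⟫ :=
  ⟨M.measurable_gain hm, h0⟩

/-- Capital times position stays equal to `h`, so shrinking the capital costs none of the gain. -/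
theorem gain_le_scaled_wealth (n : ℕ) (ω : Ω) :
    ⟪h ω, M.R k ω⟫ ≤
      1 / ((n : ℝ) + 1) * (1 + ⟪((n : ℝ) + 1) • h ω, M.R k ω⟫) := by
  have hn : (0 : ℝ) < (n : ℝ) + 1 := by positivity
  rw [real_inner_smul_left, mul_add, ← mul_assoc, one_div_mul_cancel hn.ne', one_mul]
  have : 0 < 1 / ((n : ℝ) + 1) := by positivity
  linarith

theorem not_NA1_of_arbitrage_direction
    (hm : Measurable[M.F k.castSucc] h) (hmem : ∀ ω, h ω ∈ M.Θhat k ω)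
    (h0 : ∀ᵐ ω ∂P, 0 ≤ ⟪h ω, M.R k ω⟫) (hne : ¬ ∀ᵐ ω ∂P, ⟪h ω, M.R k ω⟫ = 0) : ¬ M.NA1 := by
  intro hNA
  refine hne (hNA _ ⟨(M.measurable_gain hm).mono (M.F.mono (Fin.le_last _)) le_rfl, h0⟩
    (ENNReal.eq_zero_of_forall_le_ofReal_one_div fun n => sInf_le
      ⟨_, ⟨by positivity, _, M.isStrategyIn_single M.zero_mem_Θ
        (M.isPositionIn_smul hm hmem (c := (n : ℝ) + 1) (by positivity)),
        Filter.Eventually.of_forall fun ω => ?_⟩, rfl⟩))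
  rw [wealth_last_single]
  exact M.gain_le_scaled_wealth n ω

theorem not_NA1Period_of_arbitrage_direction
    (hm : Measurable[M.F k.castSucc] h) (hmem : ∀ ω, h ω ∈ M.Θhat k ω)
    (h0 : ∀ᵐ ω ∂P, 0 ≤ ⟪h ω, M.R k ω⟫) (hne : ¬ ∀ᵐ ω ∂P, ⟪h ω, M.R k ω⟫ = 0) : ¬ M.NA1Period k := by
  intro hNA
  refine hne (hNA _ (M.isClaim_gain hm h0) 0 ⟨@measurable_const _ _ _ (M.F k.castSucc) 0,
    fun x _ => Filter.Eventually.of_forall fun ω => zero_le, fun g' _ hg' => ?_⟩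
    (Filter.Eventually.of_forall fun _ => rfl))
  have hall : ∀ᵐ ω ∂P, ∀ n : ℕ, g' ω ≤ ENNReal.ofReal (1 / ((n : ℝ) + 1)) := by
    refine ae_all_iff.2 fun n => hg' (fun _ => 1 / ((n : ℝ) + 1))
      ⟨⟨@measurable_const _ _ _ (M.F k.castSucc) _, Filter.Eventually.of_forall fun _ => ?_⟩, _,
        M.isPositionIn_smul hm hmem (c := (n : ℝ) + 1) (by positivity),
        Filter.Eventually.of_forall (M.gain_le_scaled_wealth n)⟩
    positivity
  filter_upwards [hall] with ω hω
  exact (ENNReal.eq_zero_of_forall_le_ofReal_one_div hω).le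

theorem exists_isArbitrage_of_arbitrage_direction [IsProbabilityMeasure P]
    (hm : Measurable[M.F k.castSucc] h) (hmem : ∀ ω, h ω ∈ M.Θhat k ω)
    (h0 : ∀ᵐ ω ∂P, 0 ≤ ⟪h ω, M.R k ω⟫) (hne : ¬ ∀ᵐ ω ∂P, ⟪h ω, M.R k ω⟫ = 0) :
    ∃ π, M.IsStrategyIn M.Θhat π ∧ M.IsArbitrage π := by
  refine ⟨Pi.single k h, M.isStrategyIn_single M.zero_mem_Θhat
    ⟨hm, Filter.Eventually.of_forall hmem⟩, ?_, ?_⟩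
  · simp only [wealth_last_single, one_mul, le_add_iff_nonneg_right]
    exact (measure_congr (Filter.eventuallyEq_univ.2 h0)).trans measure_univ
  · simp only [wealth_last_single, one_mul, lt_add_iff_pos_right]
    rw [pos_iff_ne_zero]
    intro hz
    refine hne ?_
    have hz' : ∀ᵐ ω ∂P, ¬ 0 < ⟪h ω, M.R k ω⟫ := by
      rw [ae_iff]; simpa using hz
    filter_upwards [h0, hz'] with ω h1 h2 using le_antisymm (not_lt.1 h2) h1

end SinglePeriod

/-! ### From boundedness to no arbitrage. -/

theorem not_exists_isArbitrage [IsProbabilityMeasure P]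
    (h : ∀ k, ∀ᵐ ω ∂P, M.Θhat k ω = ((M.L k ω)ᗮ : Submodule ℝ (EuclideanSpace ℝ (Fin d)))) :
    ¬ ∃ π, M.IsStrategyIn M.Θhat π ∧ M.IsArbitrage π := by
  rintro ⟨π, hπ, -, hpos⟩
  refine hpos.ne' (measure_eq_zero_iff_ae_notMem.2 ?_)
  have hall : ∀ᵐ ω ∂P, ∀ k, ⟪π k ω, M.R k ω⟫ = 0 := by
    refine ae_all_iff.2 fun k => ?_
    filter_upwards [h k, (hπ k).2, M.ae_R_mem_condSupport k] with ω h1 h2 h3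
    rw [h1] at h2
    exact (M.mem_orthogonal_L_iff k ω).1 h2 _ h3
  filter_upwards [hall] with ω hω
  simp [wealth_last, hω]

theorem ae_exists_forall_mem_Θ_abs_inner_le
    (h : ∀ k, ∀ᵐ ω ∂P, Bornology.IsBounded (M.Θ k ω ∩ M.L k ω)) (k : Fin T) :
    ∀ᵐ ω ∂P, ∃ C : ℝ, ∀ y ∈ M.Θ k ω, |⟪y, M.R k ω⟫| ≤ C := by
  filter_upwards [h k, M.ae_R_mem_condSupport k] with ω h1 h2
  exact M.exists_forall_mem_Θ_abs_inner_le k ω h1 h2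

/-- Almost surely one bound on the growth factor serves all the super-hedging strategies, while
their capitals tend to zero. The argument is pathwise, so the bound need not be measurable. -/
theorem NA1_of_isBounded (h : ∀ k, ∀ᵐ ω ∂P, Bornology.IsBounded (M.Θ k ω ∩ M.L k ω)) :
    M.NA1 := by
  intro ξ hξ hv
  have hex (n : ℕ) : ∃ v : ℝ, 0 < v ∧ v < 1 / ((n : ℝ) + 1) ∧ ∃ π, M.IsStrategyIn M.Θ π ∧
      ∀ᵐ ω ∂P, ξ ω ≤ M.wealth v π (Fin.last T) ω := by
    have hlt : M.superhedgingValue ξ < ENNReal.ofReal (1 / ((n : ℝ) + 1)) := by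
      rw [hv, ENNReal.ofReal_pos]; positivity
    obtain ⟨_, ⟨v, ⟨hv0, hπ⟩, rfl⟩, hvlt⟩ := sInf_lt_iff.1 hlt
    exact ⟨v, hv0, (ENNReal.ofReal_lt_ofReal_iff (by positivity)).1 hvlt, hπ⟩
  choose v hv0 hvlt π hπ hle using hex
  have hbd := ae_all_iff.2 (M.ae_exists_forall_mem_Θ_abs_inner_le h)
  have hmem : ∀ᵐ ω ∂P, ∀ n k, π n k ω ∈ M.Θ k ω :=
    ae_all_iff.2 fun n => ae_all_iff.2 fun k => (hπ n k).2
  filter_upwards [hbd, hmem, ae_all_iff.2 hle, hξ.2] with ω hC hmem hle hpos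
  choose C hC using hC
  refine le_antisymm (ge_of_tendsto' (x := Filter.atTop)
    (f := fun n : ℕ => 1 / ((n : ℝ) + 1) * ∏ k, (1 + C k)) ?_ fun n => ?_) hpos
  · simpa using tendsto_one_div_add_atTop_nhds_zero_nat.mul_const (∏ k, (1 + C k))
  · have hprod : |∏ k, (1 + ⟪π n k ω, M.R k ω⟫)| ≤ ∏ k, (1 + C k) := by
      rw [Finset.abs_prod]
      refine Finset.prod_le_prod (fun _ _ => abs_nonneg _) fun k _ => ?_
      calc |1 + ⟪π n k ω, M.R k ω⟫| ≤ |1| + |⟪π n k ω, M.R k ω⟫| := abs_add_le _ _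
        _ ≤ 1 + C k := by rw [abs_one]; linarith [hC k _ (hmem n k)]
    calc ξ ω ≤ v n * ∏ k, (1 + ⟪π n k ω, M.R k ω⟫) := by rw [← wealth_last]; exact hle n
      _ ≤ v n * ∏ k, (1 + C k) :=
        mul_le_mul_of_nonneg_left ((le_abs_self _).trans hprod) (hv0 n).le
      _ ≤ 1 / ((n : ℝ) + 1) * ∏ k, (1 + C k) :=
        mul_le_mul_of_nonneg_right (hvlt n).le ((abs_nonneg _).trans hprod)

theorem NA1Period_of_isBounded [IsProbabilityMeasure P]
    (h : ∀ k, ∀ᵐ ω ∂P, Bornology.IsBounded (M.Θ k ω ∩ M.L k ω)) (k : Fin T) :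
    M.NA1Period k := by
  intro ζ hζ g hg hg0
  obtain ⟨f, hf, hfmem, hfd⟩ := M.exists_measurable_dense_Θ k
  have hfac := M.ae_exists_forall_mem_Θ_abs_inner_le h k
  -- Here the bound must be measurable, so it is taken over the countable dense family. Where the
  -- supremum is infinite, a null event, the real `⨆` is `0`, so `1 + W` is positive everywhere.
  set W : Ω → ℝ := fun ω => ⨆ n, |⟪f n ω, M.R k ω⟫|
  have hWm : Measurable W := Measurable.iSup fun n =>
    ((M.measurable_gain (hf n)).mono (M.F.le _) le_rfl).abs
  have hW0 : ∀ ω, 0 ≤ W ω := fun ω => Real.iSup_nonneg fun n => abs_nonneg _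
  have hWle : ∀ᵐ ω ∂P, ∀ y ∈ M.Θ k ω, ⟪y, M.R k ω⟫ ≤ W ω := by
    filter_upwards [hfac] with ω hω y hy
    obtain ⟨C, hC⟩ := hω
    have hbdd : BddAbove (Set.range fun n => |⟪f n ω, M.R k ω⟫|) :=
      ⟨C, by rintro _ ⟨n, rfl⟩; exact hC _ (hfmem n ω)⟩
    have hcl : IsClosed {y : EuclideanSpace ℝ (Fin d) | ⟪y, M.R k ω⟫ ≤ W ω} :=
      isClosed_le (continuous_id.inner continuous_const) continuous_const
    refine closure_minimal ?_ hcl (hfd ω hy)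
    rintro _ ⟨n, rfl⟩
    exact (le_abs_self _).trans (le_ciSup hbdd n)
  have hpos : ∀ ω, 0 < 1 + W ω := fun ω => by linarith [hW0 ω]
  -- Every super-hedging capital `x` satisfies `ζ ≤ x * (1 + W)` a.s., so `ζ / (1 + W)` lies below
  -- all of them.
  have hzero := ae_eq_zero_of_isEssInfFamily_majorants (M.F.le _) (fun x hx => hx.1.1) hg hg0
    (Y := fun ω => ζ ω / (1 + W ω)) ((hζ.1.mono (M.F.le _) le_rfl).div (hWm.const_add 1))
    (hζ.2.mono fun ω hω => div_nonneg hω (hpos ω).le) ?_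
  · filter_upwards [hzero] with ω hω
    exact (div_eq_zero_iff.1 hω).resolve_right (hpos ω).ne'
  · rintro x ⟨hx, h', hh', hle⟩
    filter_upwards [hx.2, hh'.2, hle, hWle] with ω h1 h2 h3 h4
    rw [div_le_iff₀ (hpos ω)]
    exact h3.trans (mul_le_mul_of_nonneg_left (by linarith [h4 _ h2]) h1)

end ConstrainedMarket

theorem proposition4p2 {Ω : Type*} [mΩ : MeasurableSpace Ω] (P : Measure Ω)
    [IsProbabilityMeasure P] (T d : ℕ) (M : ConstrainedMarket P T d) :
    List.TFAE [
      M.NA1,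
      ¬ ∃ π, M.IsStrategyIn M.Θhat π ∧ M.IsArbitrage π,
      ∀ k, M.NA1Period k,
      ∀ k, ∀ᵐ ω ∂P, M.Iarb k ω ∩ M.Θhat k ω = ∅,
      ∀ k, ∀ᵐ ω ∂P,
        M.Θhat k ω = ((M.L k ω)ᗮ : Submodule ℝ (EuclideanSpace ℝ (Fin d))),
      ∀ k, ∀ᵐ ω ∂P, Bornology.IsBounded (M.Θ k ω ∩ M.L k ω)] ∧
    (∀ k ω, Bornology.IsBounded (M.Θ k ω ∩ M.L k ω) → IsCompact (M.Θ k ω ∩ M.L k ω)) := by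
  refine ⟨?_, M.isCompact_Θ_inter_L⟩
  tfae_have 4 ↔ 5 := by simp only [M.Iarb_inter_Θhat_eq_empty_iff]
  tfae_have 5 ↔ 6 := by simp only [M.Θhat_eq_orthogonal_iff_isBounded]
  tfae_have 5 → 2 := M.not_exists_isArbitrage
  tfae_have 6 → 1 := M.NA1_of_isBounded
  tfae_have 6 → 3 := M.NA1Period_of_isBounded
  tfae_have 1 → 4 := by
    intro hNA k
    by_contra hk
    obtain ⟨h, hm, hmem, h0, hne⟩ := M.exists_measurable_arbitrage_direction k hk
    exact M.not_NA1_of_arbitrage_direction hm hmem h0 hne hNA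
  tfae_have 2 → 4 := by
    intro hNA k
    by_contra hk
    obtain ⟨h, hm, hmem, h0, hne⟩ := M.exists_measurable_arbitrage_direction k hk
    exact hNA (M.exists_isArbitrage_of_arbitrage_direction hm hmem h0 hne)
  tfae_have 3 → 4 := by
    intro hNA k
    by_contra hk
    obtain ⟨h, hm, hmem, h0, hne⟩ := M.exists_measurable_arbitrage_direction k hk
    exact M.not_NA1Period_of_arbitrage_direction hm hmem h0 hne (hNA k)
  tfae_finish
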